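/- Let $V_A,V_B$ be finite-dimensional real vector spaces and let $\mathsf{C}_A\subset V_A$, $\mathsf{C}_B\subset V_B$ be proper cones, i.e. convex cones (containing $0$) that are closed, contain no line, and are not contained in any hyperplane. Write $\mathsf{C}^*=\{f\in V^* : f(v)\ge 0 \text{ for all } v\in\mathsf{C}\}$ for the dual of a cone $\mathsf{C}\subset V$, and \[ \mathsf{C}\otimes_{\min}\mathsf{C}'=\operatorname{conv}\{v\otimes w : v\in\mathsf{C},\ w\in\mathsf{C}'\}, \] \[ \mathsf{C}\otimes_{\max}\mathsf{C}'=\{z\in V\otimes V' : (f\otimes g)(z)\ge 0 \text{ for all } f\in\mathsf{C}^*,\ g\in(\mathsf{C}')^*\} \] for cones $\mathsf{C}\subset V$, $\mathsf{C}'\subset V'$, and $\mathsf{C}^{\otimes_{\min}k}=\operatorname{conv}\{v_1\otimes\cdots\otimes v_k : v_1,\dots,v_k\in\mathsf{C}\}\subset V^{\otimes k}$. For $k\ge 1$ let \[ P_{\mathrm{Sym}_k(V_B)}=\frac{1}{k!}\sum_{\sigma\in\mathfrak{S}_k}U_\sigma : V_B^{\otimes k}\to V_B^{\otimes k}, \]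 where $U_\sigma$ is the linear map with $U_\sigma(v_1\otimes\cdots\otimes v_k)=v_{\sigma^{-1}(1)}\otimes\cdots\otimes v_{\sigma^{-1}(k)}$. Then for every $x\in V_A\otimes V_B$ in the interior of $\mathsf{C}_A\otimes_{\max}\mathsf{C}_B$ and every $y$ in the interior of $\mathsf{C}_B$, there is an integer $k\ge 1$ such that \[ \left(\mathrm{Id}_{V_A}\otimes P_{\mathrm{Sym}_k(V_B)}\right)\left(x\otimes y^{\otimes(k-1)}\right)\in \mathsf{C}_A\otimes_{\min}\mathsf{C}_B^{\otimes_{\min}k}, \] where $x\otimes y^{\otimes(k-1)}$ is regarded as an element of $V_A\otimes V_B^{\otimes k}$. -/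

import Mathlib

open scoped TensorProduct

namespace ConeTensor

noncomputable section

/-- A convex cone (containing `0`) in a real vector space `V` is *proper* if it is closed, contains
no line, and is not contained in any hyperplane. Closedness refers to the canonical vector space
topology, which for finite-dimensional `V` is the module topology. As the cone contains `0`, a
hyperplane containing it is the kernel of a nonzero linear form. -/
structure IsProper {V : Type*} [AddCommGroup V] [Module ℝ V] (C : PointedCone ℝ V) : Prop where
  isClosed : @IsClosed V (moduleTopology ℝ V) (C : Set V)
  no_line : ∀ a d : V, d ≠ 0 → ¬ ∀ t : ℝ, a + t • d ∈ C
  not_le_hyperplane : ∀ f : Module.Dual ℝ V, f ≠ 0 → ¬ ∀ v ∈ C, f v = 0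

/-- The interior of a cone for the canonical topology of a finite-dimensional real vector space. -/
def inter {V : Type*} [AddCommGroup V] [Module ℝ V] (C : PointedCone ℝ V) : Set V :=
  @interior V (moduleTopology ℝ V) (C : Set V)

/-- The `k`-fold minimal tensor power of a cone: the conical hull of the product tensors
`v₁ ⊗ ⋯ ⊗ vₖ` of elements of the cone. -/
def minTensorPower {V : Type*} [AddCommGroup V] [Module ℝ V] (k : ℕ) (C : PointedCone ℝ V) :
    PointedCone ℝ (⨂[ℝ]^k V) :=
  PointedCone.hull ℝ {z | ∃ v : Fin k → V, (∀ i, v i ∈ C) ∧ z = PiTensorProduct.tprod ℝ v}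

/-- The action of a permutation on the tensor power,
`U_σ (x₁ ⊗ ⋯ ⊗ xₖ) = x_{σ⁻¹(1)} ⊗ ⋯ ⊗ x_{σ⁻¹(k)}`. -/
def permAction (V : Type*) [AddCommGroup V] [Module ℝ V] (k : ℕ) (σ : Equiv.Perm (Fin k)) :
    ⨂[ℝ]^k V →ₗ[ℝ] ⨂[ℝ]^k V :=
  (PiTensorProduct.reindex ℝ (fun _ : Fin k => V) σ).toLinearMap

/-- The symmetric projection `(1 / k!) ∑_σ U_σ`. -/
def symProj (V : Type*) [AddCommGroup V] [Module ℝ V] (k : ℕ) : ⨂[ℝ]^k V →ₗ[ℝ] ⨂[ℝ]^k V :=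
  (1 / (k.factorial : ℝ)) • ∑ σ : Equiv.Perm (Fin k), permAction V k σ

/-- For `k ≥ 1`, the linear map `v ↦ v ⊗ y^{⊗(k-1)} = v ⊗ y ⊗ ⋯ ⊗ y` into the `k`-th tensor
power. -/
def tmulPow {V : Type*} [AddCommGroup V] [Module ℝ V] (k : ℕ) (hk : 1 ≤ k) (y : V) :
    V →ₗ[ℝ] ⨂[ℝ]^k V :=
  (PiTensorProduct.tprod ℝ : MultilinearMap ℝ (fun _ : Fin k => V) (⨂[ℝ]^k V)).toLinearMap
    (fun _ => y) ⟨0, hk⟩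

end

end ConeTensor

/-! Choose finitely many `b i` in `CB` that span, sum to `y`, and are rich enough that every nonzero
form `g` nonnegative on all of them contracts `x` into the interior of `CA`
(`exists_spanning_certificate`). Write x = ∑ xs_i ⊗ b_i. The symmetrized tensor is then a sum over
words f of length k of (∑ p_i xs_i) ⊗ b_{f(1)} ⊗ ⋯ ⊗ b_{f(k)}, where p is the vector of letter
frequencies of f.

If p_i = g(b_i) for some form g, the coefficient is a contraction of `x`, hence interior. Any other
p violates a linear relation r among the b_i. But such relations make the expansion non-unique:
weighting the words by ∑_{s≠s'} r(f s) r(f s') gives a vanishing sum, so multiples of this weight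
times an interior point a of `CA` can be added to the coefficients
(`ConeTensor.symProj_tmulPow_expansion`). The weight is k²(∑ r_i p_i)² up to O(k), a reward exactly
where the relation fails. Compactness of the simplex (`PointedCone.exists_penalty`) then puts all
coefficients in `CA` for one k. -/

open scoped TensorProduct Topology
open Module Filter

/-! ### Symmetrization and multilinear expansions -/

section SymmetricProjection

variable {V : Type*} [AddCommGroup V] [Module ℝ V]

/-- Right translation by a transposition shows that the sum over permutations does not depend on
`a`. This turns the average over permutations into an average over positions. -/
theorem Equiv.Perm.card_nsmul_sum_apply {ι M : Type*} [Fintype ι] [DecidableEq ι]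
    [AddCommMonoid M] (F : ι → M) (a : ι) :
    Fintype.card ι • ∑ σ : Equiv.Perm ι, F (σ a) =
      (Fintype.card ι).factorial • ∑ s, F s := by
  have hG : ∀ s, ∑ σ : Equiv.Perm ι, F (σ s) = ∑ σ : Equiv.Perm ι, F (σ a) := fun s =>
    Fintype.sum_equiv (Equiv.mulRight (Equiv.swap a s)) _ _ (fun σ => by simp)
  calc Fintype.card ι • ∑ σ : Equiv.Perm ι, F (σ a)
      = ∑ s, ∑ σ : Equiv.Perm ι, F (σ s) := by simp [hG]
    _ = ∑ σ : Equiv.Perm ι, ∑ s, F (σ s) := Finset.sum_comm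
    _ = ∑ _σ : Equiv.Perm ι, ∑ s, F s :=
        Finset.sum_congr rfl fun σ _ => Equiv.sum_comp σ F
    _ = _ := by simp [Fintype.card_perm]

theorem ConeTensor.symProj_tmulPow (k : ℕ) (hk : 1 ≤ k) (y v : V) :
    ConeTensor.symProj V k (ConeTensor.tmulPow k hk y v) =
      (1 / (k : ℝ)) • ∑ s : Fin k, PiTensorProduct.tprod ℝ (Function.update (fun _ => y) s v) := by
  have h1 : ∀ σ : Equiv.Perm (Fin k), ConeTensor.permAction V k σ (ConeTensor.tmulPow k hk y v) =
      PiTensorProduct.tprod ℝ (Function.update (fun _ => y) (σ ⟨0, hk⟩) v) := by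
    intro σ
    simp only [ConeTensor.permAction, ConeTensor.tmulPow, MultilinearMap.toLinearMap_apply,
      LinearEquiv.coe_coe]
    erw [PiTensorProduct.reindex_tprod]
    congr 1
    ext i
    by_cases h : i = σ ⟨0, hk⟩
    · subst h; simp
    · rw [Function.update_of_ne h, Function.update_of_ne]
      rintro h'
      exact h (by rw [← h']; simp)
  have h2 := Equiv.Perm.card_nsmul_sum_apply
    (fun s : Fin k => PiTensorProduct.tprod ℝ (Function.update (fun _ => y) s v)) ⟨0, hk⟩
  simp only [Fintype.card_fin] at h2
  rw [← Nat.cast_smul_eq_nsmul ℝ, ← Nat.cast_smul_eq_nsmul ℝ] at h2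
  have hk0 : (k : ℝ) ≠ 0 := by positivity
  have hf0 : (k.factorial : ℝ) ≠ 0 := by positivity
  simp only [ConeTensor.symProj, LinearMap.smul_apply, LinearMap.sum_apply, h1]
  rw [one_div, one_div, inv_smul_eq_iff₀ hf0, smul_comm, ← h2, smul_smul, inv_mul_cancel₀ hk0,
    one_smul]

theorem MultilinearMap.map_weighted_sum {κ ι M : Type*} [Fintype κ] [DecidableEq κ] [Fintype ι]
    [AddCommGroup M] [Module ℝ M] (F : MultilinearMap ℝ (fun _ : κ => V) M) (b : ι → V)
    (w : κ → ι → ℝ) :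
    F (fun s => ∑ i, w s i • b i) = ∑ f : κ → ι, (∏ s, w s (f s)) • F (fun s => b (f s)) := by
  classical
  rw [MultilinearMap.map_sum]
  exact Finset.sum_congr rfl fun f _ => F.map_smul_univ _ _

theorem MultilinearMap.map_update_weighted_sum {κ ι M : Type*} [Fintype κ] [DecidableEq κ]
    [Fintype ι] [AddCommGroup M] [Module ℝ M] (F : MultilinearMap ℝ (fun _ : κ => V) M)
    (b : ι → V) (t : ι → ℝ) (s : κ) :
    F (Function.update (fun _ => ∑ i, b i) s (∑ i, t i • b i)) =
      ∑ f : κ → ι, t (f s) • F (fun l => b (f l)) := by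
  have h := F.map_weighted_sum b (fun l i => if l = s then t i else 1)
  simp only [Finset.prod_ite_eq', Finset.mem_univ, if_true] at h
  rw [← h]
  congr 1
  ext l
  by_cases hl : l = s
  · subst hl; simp
  · simp [hl]

/-- The sum factors as `F` with ∑ r_i b_i = 0 in slot `s`; `s ≠ s'` keeps the factor `r'` out of
that slot. -/
theorem MultilinearMap.sum_relation_smul_eq_zero {κ ι M : Type*} [Fintype κ] [DecidableEq κ]
    [Fintype ι] [AddCommGroup M] [Module ℝ M] (F : MultilinearMap ℝ (fun _ : κ => V) M)
    (b : ι → V) (r r' : ι → ℝ) (hr : ∑ i, r i • b i = 0) {s s' : κ} (hs : s ≠ s') :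
    ∑ f : κ → ι, (r (f s) * r' (f s')) • F (fun l => b (f l)) = 0 := by
  have h := F.map_weighted_sum b (fun l i => (if l = s then r i else 1) * if l = s' then r' i else 1)
  simp only [Finset.prod_mul_distrib, Finset.prod_ite_eq', Finset.mem_univ, if_true] at h
  rw [← h]
  refine F.map_coord_zero s ?_
  simp [hs, hr]

/-- The weight is the sum of r(f s) r(f s') over s ≠ s'. The diagonal must be removed because it
would place ∑ r_i² b_i, which need not vanish, in a slot. -/
theorem MultilinearMap.sum_offDiag_relation_smul_eq_zero {κ ι M : Type*} [Fintype κ]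
    [DecidableEq κ] [Fintype ι] [AddCommGroup M] [Module ℝ M]
    (F : MultilinearMap ℝ (fun _ : κ => V) M) (b : ι → V) (r : ι → ℝ)
    (hr : ∑ i, r i • b i = 0) :
    ∑ f : κ → ι, ((∑ s, r (f s)) ^ 2 - ∑ s, r (f s) ^ 2) • F (fun l => b (f l)) = 0 := by
  have h : ∀ f : κ → ι, ((∑ s, r (f s)) ^ 2 - ∑ s, r (f s) ^ 2) =
      ∑ s, ∑ s', if s = s' then 0 else r (f s) * r (f s') := by
    intro f
    rw [sq, Finset.sum_mul_sum, ← Finset.sum_sub_distrib]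
    refine Finset.sum_congr rfl fun s _ => ?_
    have : ∀ s', (if s = s' then 0 else r (f s) * r (f s')) =
        r (f s) * r (f s') - if s = s' then r (f s) * r (f s') else 0 := fun s' => by
      split_ifs <;> simp
    simp only [this, Finset.sum_sub_distrib, Finset.sum_ite_eq, Finset.mem_univ, if_true, sq]
  simp only [h, Finset.sum_smul]
  rw [Finset.sum_comm]
  refine Finset.sum_eq_zero fun s _ => ?_
  rw [Finset.sum_comm]
  refine Finset.sum_eq_zero fun s' _ => ?_
  by_cases hs : s = s'
  · simp [hs]
  · simpa [hs] using F.sum_relation_smul_eq_zero b r r hr hs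

/-- The terms with `c` and `a` sum to zero; they are kept as freedom for moving each coefficient
into the cone. -/
theorem ConeTensor.symProj_tmulPow_expansion {W ι J : Type*} [AddCommGroup W] [Module ℝ W]
    [Fintype ι] [Fintype J] (k : ℕ) (hk : 1 ≤ k) (b : ι → V) (xs : ι → W) (r : J → ι → ℝ)
    (hr : ∀ j, ∑ i, r j i • b i = 0) (c : ℝ) (a : W) :
    TensorProduct.map LinearMap.id (ConeTensor.symProj V k)
        (TensorProduct.map LinearMap.id (ConeTensor.tmulPow k hk (∑ i, b i))
          (∑ i, xs i ⊗ₜ[ℝ] b i)) =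
      ∑ f : Fin k → ι, ((1 / (k : ℝ)) • ∑ s, xs (f s) +
        (c * ∑ j, ((∑ s, r j (f s)) ^ 2 - ∑ s, r j (f s) ^ 2)) • a) ⊗ₜ[ℝ]
          (PiTensorProduct.tprod ℝ (fun l => b (f l)) : ⨂[ℝ]^k V) := by
  classical
  set F : MultilinearMap ℝ (fun _ : Fin k => V) (⨂[ℝ]^k V) := PiTensorProduct.tprod ℝ with hF
  have hvanish : ∑ f : Fin k → ι, ((c * ∑ j, ((∑ s, r j (f s)) ^ 2 - ∑ s, r j (f s) ^ 2)) • a)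
      ⊗ₜ[ℝ] F (fun l => b (f l)) = 0 := by
    simp only [TensorProduct.smul_tmul, ← TensorProduct.tmul_sum]
    simp only [mul_smul, ← Finset.smul_sum, Finset.sum_smul]
    rw [Finset.sum_comm]
    simp [F.sum_offDiag_relation_smul_eq_zero b _ (hr _)]
  have hupd : ∀ (i : ι) (s : Fin k), F (Function.update (fun _ => ∑ i, b i) s (b i)) =
      ∑ f : Fin k → ι, (if f s = i then (1 : ℝ) else 0) • F (fun l => b (f l)) := by
    intro i s
    rw [← F.map_update_weighted_sum b (fun j => if j = i then 1 else 0) s]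
    simp
  simp only [TensorProduct.add_tmul, Finset.sum_add_distrib, hvanish, add_zero]
  simp only [map_sum, TensorProduct.map_tmul, LinearMap.id_apply, ConeTensor.symProj_tmulPow]
  simp only [← hF, hupd, TensorProduct.tmul_smul, TensorProduct.tmul_sum, TensorProduct.smul_tmul',
    ← Finset.smul_sum]
  simp only [← TensorProduct.smul_tmul', ← Finset.smul_sum, TensorProduct.sum_tmul]
  congr 1
  rw [Finset.sum_comm, Finset.sum_comm (s := (Finset.univ : Finset (Fin k → ι)))]
  refine Finset.sum_congr rfl fun s _ => ?_
  rw [Finset.sum_comm]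
  refine Finset.sum_congr rfl fun f _ => ?_
  simp [ite_smul]

end SymmetricProjection

/-! ### Convex cones: separation, interiors, penalties -/

section Cones

variable {V : Type*} [AddCommGroup V] [Module ℝ V]

theorem PointedCone.span_eq_top_of_not_le_hyperplane {C : PointedCone ℝ V}
    (h : ∀ f : Module.Dual ℝ V, f ≠ 0 → ¬ ∀ v ∈ C, f v = 0) :
    Submodule.span ℝ (C : Set V) = ⊤ := by
  by_contra hne
  obtain ⟨f, hf, hle⟩ := Submodule.exists_le_ker_of_lt_top _ (lt_top_iff_ne_top.2 hne)
  exact h f hf fun v hv => hle (Submodule.subset_span hv)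

/-- A norm on a finite-dimensional real vector space, pulled back along coordinates. -/
noncomputable abbrev coordinateNorm (V : Type*) [AddCommGroup V] [Module ℝ V] [Module.Finite ℝ V] :
    NormedAddCommGroup V :=
  NormedAddCommGroup.induced V (Fin (finrank ℝ V) → ℝ) (finBasis ℝ V).equivFun
    (finBasis ℝ V).equivFun.injective

/-- The coordinate norm is homogeneous. -/
noncomputable abbrev coordinateNormedSpace (V : Type*) [AddCommGroup V] [Module ℝ V]
    [Module.Finite ℝ V] : @NormedSpace ℝ V _ (coordinateNorm V).toSeminormedAddCommGroup :=
  letI := coordinateNorm V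
  NormedSpace.induced ℝ V (Fin (finrank ℝ V) → ℝ) (finBasis ℝ V).equivFun

theorem moduleTopology_eq_coordinateNorm [Module.Finite ℝ V] :
    moduleTopology ℝ V = (coordinateNorm V).toPseudoMetricSpace.toUniformSpace.toTopologicalSpace :=
  by
  let := coordinateNorm V
  let := coordinateNormedSpace V
  have : IsModuleTopology ℝ V := isModuleTopologyOfFiniteDimensional
  exact (IsModuleTopology.eq_moduleTopology' (R := ℝ)).symm

/-- Bipolar theorem; the auxiliary norm induces the module topology and gives access to Hahn–Banach
separation. -/
theorem PointedCone.mem_of_forall_dual_nonneg [Module.Finite ℝ V] {C : PointedCone ℝ V}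
    (hC : @IsClosed V (moduleTopology ℝ V) (C : Set V)) {v : V}
    (hv : ∀ f : Module.Dual ℝ V, (∀ w ∈ C, 0 ≤ f w) → 0 ≤ f v) : v ∈ C := by
  rw [moduleTopology_eq_coordinateNorm] at hC
  let := coordinateNorm V
  let := coordinateNormedSpace V
  by_contra hvC
  obtain ⟨f, hf, hfv⟩ :=
    ProperCone.hyperplane_separation_point (⟨C, hC⟩ : ProperCone ℝ V) (x₀ := v) hvC
  exact (hv f.toLinearMap fun w hw => hf w hw).not_gt hfv

theorem PointedCone.interior_nonempty_of_span_eq_top [Module.Finite ℝ V] {C : PointedCone ℝ V}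
    (hC : Submodule.span ℝ (C : Set V) = ⊤) : (ConeTensor.inter C).Nonempty := by
  rw [ConeTensor.inter, moduleTopology_eq_coordinateNorm]
  let := coordinateNorm V
  let := coordinateNormedSpace V
  have hconv : Convex ℝ (C : Set V) := C.convex
  refine (hconv.interior_nonempty_iff_affineSpan_eq_top).2 ?_
  have h0 : (C : Set V) = insert 0 (C : Set V) := by
    rw [Set.insert_eq_of_mem]; exact C.zero_mem
  rw [h0]
  refine SetLike.coe_injective ?_
  rw [affineSpan_insert_zero, hC]
  simp

variable [TopologicalSpace V]

theorem PointedCone.add_mem_interior [IsTopologicalAddGroup V] {C : PointedCone ℝ V} {u v : V}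
    (hu : u ∈ interior (C : Set V)) (hv : v ∈ C) : u + v ∈ interior (C : Set V) := by
  refine interior_maximal ?_ (isOpen_interior.add_right (t := {v}))
    (Set.add_mem_add hu (Set.mem_singleton v))
  rintro _ ⟨a, ha, _, rfl, rfl⟩
  exact C.add_mem (interior_subset ha) hv

theorem PointedCone.smul_mem_interior [ContinuousSMul ℝ V] {C : PointedCone ℝ V} {c : ℝ} (hc : 0 < c) {v : V}
    (hv : v ∈ interior (C : Set V)) : c • v ∈ interior (C : Set V) := by
  refine interior_maximal ?_ (isOpen_interior.smul₀ hc.ne') (Set.smul_mem_smul_set hv)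
  rintro _ ⟨a, ha, rfl⟩
  exact C.smul_mem hc.le (interior_subset ha)

variable [IsTopologicalAddGroup V] [ContinuousSMul ℝ V]

theorem PointedCone.exists_add_smul_mem {C : PointedCone ℝ V} {y : V}
    (hy : y ∈ interior (C : Set V)) (v : V) : ∃ ε : ℝ, 0 < ε ∧ y + ε • v ∈ C := by
  have ht : Tendsto (fun ε : ℝ => y + ε • v) (𝓝[>] 0) (𝓝 y) := by
    have : ContinuousAt (fun ε : ℝ => y + ε • v) 0 := by fun_prop
    simpa using this.tendsto.mono_left nhdsWithin_le_nhds
  obtain ⟨ε, h, hε⟩ := ((ht.eventually (mem_interior_iff_mem_nhds.1 hy)).and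
    self_mem_nhdsWithin).exists
  exact ⟨ε, hε, h⟩

/-- On the standard simplex, a linear map that is interior to the cone wherever `q` vanishes
becomes interior everywhere after adding a large multiple of `q` in an interior direction. -/
theorem PointedCone.exists_penalty {ι : Type*} [Fintype ι] {C : PointedCone ℝ V} {a : V}
    (ha : a ∈ interior (C : Set V)) (xs : ι → V) {q : (ι → ℝ) → ℝ} (hq : Continuous q)
    (hq0 : ∀ p, 0 ≤ q p) {D : ℝ} (hD : 0 ≤ D)
    (h : ∀ p ∈ stdSimplex ℝ ι, q p = 0 → ∑ i, p i • xs i ∈ interior (C : Set V)) :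
    ∃ m : ℕ, 1 ≤ m ∧ ∀ p ∈ stdSimplex ℝ ι,
      ∑ i, p i • xs i + (m * q p - D / m) • a ∈ interior (C : Set V) := by
  let X : (ι → ℝ) → V := fun p => ∑ i, p i • xs i
  let U : ℕ → Set (ι → ℝ) := fun n =>
    {p | X p + (((n + 1 : ℕ) : ℝ) * q p - D / ((n + 1 : ℕ) : ℝ)) • a ∈ interior (C : Set V)}
  have hX : Continuous X := by fun_prop
  have hUo : ∀ n, IsOpen (U n) := fun n => by
    refine isOpen_interior.preimage (f := fun p => X p + (((n + 1 : ℕ) : ℝ) * q p -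
      D / ((n + 1 : ℕ) : ℝ)) • a) ?_
    fun_prop
  -- The factor m q - D/m increases with m, and adding nonnegative multiples of `a` preserves the
  -- interior.
  have hmono : Monotone U := by
    intro n n' hn p hp
    have hn1 : ((n + 1 : ℕ) : ℝ) ≤ ((n' + 1 : ℕ) : ℝ) := by exact_mod_cast Nat.succ_le_succ hn
    have hpos : (0 : ℝ) < ((n + 1 : ℕ) : ℝ) := by positivity
    have h1 : D / ((n' + 1 : ℕ) : ℝ) ≤ D / ((n + 1 : ℕ) : ℝ) := by gcongr
    have h2 : ((n + 1 : ℕ) : ℝ) * q p ≤ ((n' + 1 : ℕ) : ℝ) * q p :=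
      mul_le_mul_of_nonneg_right hn1 (hq0 p)
    have := PointedCone.add_mem_interior hp (C.smul_mem
      (r := (((n' + 1 : ℕ) : ℝ) * q p - D / ((n' + 1 : ℕ) : ℝ)) -
        (((n + 1 : ℕ) : ℝ) * q p - D / ((n + 1 : ℕ) : ℝ))) (by linarith) (interior_subset ha))
    rw [add_assoc, ← add_smul, add_sub_cancel] at this
    exact this
  have hinv : Tendsto (fun n : ℕ => (((n + 1 : ℕ) : ℝ))⁻¹) atTop (𝓝 0) :=
    (tendsto_add_atTop_iff_nat 1).2 tendsto_inv_atTop_nhds_zero_nat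
  have hcover : stdSimplex ℝ ι ⊆ ⋃ n, U n := by
    intro p hp
    rw [Set.mem_iUnion]
    rcases (hq0 p).eq_or_lt with hp0 | hp0
    -- Where q vanishes, the vector tends to the interior point `X p`.
    · have ht : Tendsto (fun n : ℕ => X p + (0 - D * (((n + 1 : ℕ) : ℝ))⁻¹) • a) atTop
          (𝓝 (X p + (0 - D * 0) • a)) :=
        tendsto_const_nhds.add ((tendsto_const_nhds.sub (hinv.const_mul D)).smul_const a)
      simp only [mul_zero, sub_zero, zero_smul, add_zero] at ht
      obtain ⟨n, hn⟩ := (ht.eventually_mem (isOpen_interior.mem_nhds (h p hp hp0.symm))).exists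
      refine ⟨n, ?_⟩
      change X p + (_ * q p - _) • a ∈ interior (C : Set V)
      rwa [← hp0, mul_zero, div_eq_mul_inv]
    -- Where q is positive, the vector divided by m q tends to the interior point `a`.
    · have ht : Tendsto (fun n : ℕ => (q p)⁻¹ • (((n + 1 : ℕ) : ℝ))⁻¹ • X p +
          (1 - D * (q p)⁻¹ * ((((n + 1 : ℕ) : ℝ))⁻¹ * (((n + 1 : ℕ) : ℝ))⁻¹)) • a) atTop
          (𝓝 ((q p)⁻¹ • (0 : ℝ) • X p + (1 - D * (q p)⁻¹ * (0 * 0)) • a)) :=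
        ((hinv.smul_const _).const_smul _).add
          ((tendsto_const_nhds.sub ((hinv.mul hinv).const_mul _)).smul_const a)
      simp only [mul_zero, sub_zero, zero_smul, smul_zero, zero_add, one_smul] at ht
      obtain ⟨n, hn⟩ := (ht.eventually_mem (isOpen_interior.mem_nhds ha)).exists
      refine ⟨n, ?_⟩
      have hpos : (0 : ℝ) < ((n + 1 : ℕ) : ℝ) := by positivity
      have := PointedCone.smul_mem_interior (mul_pos hpos hp0) hn
      rw [smul_add, smul_smul, smul_smul, smul_smul] at this
      change X p + (_ * q p - _) • a ∈ interior (C : Set V)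
      convert this using 2
      · rw [show ((n + 1 : ℕ) : ℝ) * q p * (q p)⁻¹ * ((n + 1 : ℕ) : ℝ)⁻¹ = 1 by field_simp,
          one_smul]
      · congr 1
        field_simp
  obtain ⟨n, hn⟩ := (isCompact_stdSimplex ℝ ι).elim_directed_cover U hUo hcover
    hmono.directed_le
  exact ⟨n + 1, Nat.le_add_left 1 n, fun p hp => hn hp⟩

end Cones

/-! ### Contractions, finite certificates, empirical frequencies -/

section Main

variable {W V : Type*} [AddCommGroup W] [Module ℝ W] [AddCommGroup V] [Module ℝ V]

/-- Contraction of the second tensor factor with a linear form. -/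
noncomputable def tensorContract (g : Module.Dual ℝ V) : W ⊗[ℝ] V →ₗ[ℝ] W :=
  (TensorProduct.rid ℝ W).toLinearMap ∘ₗ LinearMap.lTensor W g

@[simp] theorem tensorContract_tmul (g : Module.Dual ℝ V) (w : W) (v : V) :
    tensorContract g (w ⊗ₜ[ℝ] v) = g v • w := by
  simp [tensorContract]

theorem tensorContract_surjective {g : Module.Dual ℝ V} (hg : g ≠ 0) :
    Function.Surjective (tensorContract g : W ⊗[ℝ] V →ₗ[ℝ] W) := by
  obtain ⟨v, hv⟩ : ∃ v, g v ≠ 0 := by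
    by_contra! h
    exact hg (LinearMap.ext h)
  exact fun w => ⟨w ⊗ₜ ((g v)⁻¹ • v), by simp [hv]⟩

theorem apply_tensorContract (f : Module.Dual ℝ W) (g : Module.Dual ℝ V) (x : W ⊗[ℝ] V) :
    f (tensorContract g x) = TensorProduct.dualDistrib ℝ W V (f ⊗ₜ[ℝ] g) x := by
  induction x with
  | zero => simp
  | tmul w v => simp [mul_comm]
  | add a b ha hb => simp only [map_add, ha, hb]

/-- Contraction with `g ≠ 0` is surjective, hence open, and by biduality it maps the maximal tensor
product into `CA`. -/
theorem tensorContract_mem_inter [Module.Finite ℝ W] [Module.Finite ℝ V] {CA : PointedCone ℝ W}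
    {CB : PointedCone ℝ V} (hCA : @IsClosed W (moduleTopology ℝ W) (CA : Set W))
    {x : W ⊗[ℝ] V} (hx : x ∈ ConeTensor.inter (PointedCone.maxTensorProduct CA CB))
    {g : Module.Dual ℝ V} (hg : g ≠ 0) (hgC : ∀ v ∈ CB, 0 ≤ g v) :
    tensorContract g x ∈ ConeTensor.inter CA := by
  let := moduleTopology ℝ W
  let := moduleTopology ℝ (W ⊗[ℝ] V)
  have : IsModuleTopology ℝ W := ⟨rfl⟩
  have : IsModuleTopology ℝ (W ⊗[ℝ] V) := ⟨rfl⟩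
  have : IsTopologicalAddGroup W := IsModuleTopology.topologicalAddGroup ℝ W
  have : IsTopologicalAddGroup (W ⊗[ℝ] V) := IsModuleTopology.topologicalAddGroup ℝ (W ⊗[ℝ] V)
  have hopen := IsModuleTopology.isOpenMap_of_surjective
    (φ := (tensorContract g : W ⊗[ℝ] V →ₗ[ℝ] W)) (tensorContract_surjective hg)
  refine interior_maximal ?_ (hopen _ isOpen_interior) (Set.mem_image_of_mem _ hx)
  rintro _ ⟨z, hz, rfl⟩
  refine PointedCone.mem_of_forall_dual_nonneg hCA fun f hf => ?_
  rw [apply_tensorContract]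
  exact PointedCone.mem_maxTensorProduct.1 (interior_subset hz) f hf g hgC

theorem TensorProduct.exists_eq_sum_tmul {ι : Type*} [Fintype ι] {b : ι → V}
    (hb : Submodule.span ℝ (Set.range b) = ⊤) (x : W ⊗[ℝ] V) :
    ∃ xs : ι → W, x = ∑ i, xs i ⊗ₜ[ℝ] b i := by
  induction x with
  | zero => exact ⟨0, by simp⟩
  | tmul w v =>
    obtain ⟨c, rfl⟩ := (Submodule.mem_span_range_iff_exists_fun ℝ).1
      (hb ▸ Submodule.mem_top : v ∈ Submodule.span ℝ (Set.range b))
    exact ⟨fun i => c i • w, by simp [TensorProduct.tmul_sum, TensorProduct.smul_tmul]⟩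
  | add a b ha hb =>
    obtain ⟨xs, rfl⟩ := ha
    obtain ⟨ys, rfl⟩ := hb
    exact ⟨xs + ys, by simp [TensorProduct.add_tmul, Finset.sum_add_distrib]⟩

/-- Compactness of the sphere of linear forms: finitely many elements of the cone suffice to
certify that a contraction of `x` is interior. -/
theorem exists_finset_certificate [Module.Finite ℝ V] [TopologicalSpace W]
    [IsTopologicalAddGroup W] [ContinuousSMul ℝ W] {CA : PointedCone ℝ W} {CB : PointedCone ℝ V}
    {x : W ⊗[ℝ] V}
    (hx : ∀ g : Module.Dual ℝ V, g ≠ 0 → (∀ v ∈ CB, 0 ≤ g v) →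
      tensorContract g x ∈ interior (CA : Set W)) :
    ∃ T : Finset V, (T : Set V) ⊆ CB ∧ ∀ g : Module.Dual ℝ V, g ≠ 0 → (∀ v ∈ T, 0 ≤ g v) →
      tensorContract g x ∈ interior (CA : Set W) := by
  classical
  let d := finrank ℝ (Module.Dual ℝ V)
  let e : (Fin d → ℝ) ≃ₗ[ℝ] Module.Dual ℝ V := (finBasis ℝ (Module.Dual ℝ V)).equivFun.symm
  have hX : Continuous fun c : Fin d → ℝ => tensorContract (e c) x := by
    have hlin : ∃ L : (Fin d → ℝ) →ₗ[ℝ] W, ∀ c, L c = tensorContract (e c) x :=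
      ⟨{ toFun := fun c => tensorContract (e c) x
         map_add' := fun c c' => by
          simp [tensorContract, LinearMap.lTensor_add]
         map_smul' := fun t c => by
          simp [tensorContract, LinearMap.lTensor_smul] }, fun _ => rfl⟩
    obtain ⟨L, hL⟩ := hlin
    simpa only [← hL] using L.continuous_on_pi
  have heval : ∀ v : V, Continuous fun c : Fin d → ℝ => e c v := fun v =>
    ((LinearMap.applyₗ v : Module.Dual ℝ V →ₗ[ℝ] ℝ) ∘ₗ e.toLinearMap).continuous_on_pi
  let Z : CB → Set (Fin d → ℝ) := fun b =>
    {c | 0 ≤ e c b} ∩ {c | tensorContract (e c) x ∉ interior (CA : Set W)}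
  have hZ : ∀ b, IsClosed (Z b) := fun b =>
    (isClosed_le continuous_const (heval b)).inter
      (isOpen_interior.preimage hX).isClosed_compl
  obtain ⟨u, hu⟩ := (isCompact_sphere (0 : Fin d → ℝ) 1).elim_finite_subfamily_closed Z hZ (by
    rw [Set.eq_empty_iff_forall_notMem]
    rintro c ⟨hc, hcZ⟩
    rw [Set.mem_iInter] at hcZ
    refine (hcZ 0).2 (hx (e c) ?_ fun v hv => (hcZ ⟨v, hv⟩).1)
    rw [Ne, LinearEquiv.map_eq_zero_iff]
    rintro rfl
    simp at hc)
  refine ⟨insert 0 (u.image Subtype.val), ?_, fun g hg hgT => ?_⟩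
  · intro v hv
    simp only [Finset.coe_insert, Finset.coe_image, Set.mem_insert_iff, Set.mem_image] at hv
    rcases hv with rfl | ⟨w, -, rfl⟩
    exacts [CB.zero_mem, w.2]
  · by_contra hcon
    obtain ⟨c, rfl⟩ := e.surjective g
    have hc0 : c ≠ 0 := by rintro rfl; simp at hg
    have hn : 0 < ‖c‖ := norm_pos_iff.2 hc0
    have hscale : tensorContract (e (‖c‖⁻¹ • c)) x = ‖c‖⁻¹ • tensorContract (e c) x := by
      simp [tensorContract, LinearMap.lTensor_smul]
    refine (Set.eq_empty_iff_forall_notMem.1 hu (‖c‖⁻¹ • c)) ⟨?_, ?_⟩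
    · simp [norm_smul, hn.ne']
    · refine Set.mem_iInter₂.2 fun b hb => ⟨?_, ?_⟩
      · have := hgT b (Finset.mem_insert_of_mem (Finset.mem_image_of_mem _ hb))
        simp only [map_smul, LinearMap.smul_apply, smul_eq_mul, Set.mem_ofPred_eq]
        positivity
      · intro hmem
        rw [hscale] at hmem
        have := PointedCone.smul_mem_interior hn hmem
        rw [smul_smul, mul_inv_cancel₀ hn.ne', one_smul] at this
        exact hcon this

/-- An interior point of a cone is a sum of a finite family of elements of the cone that
nonnegatively dominates any prescribed finite subset of the cone. -/
theorem exists_family_sum_eq [TopologicalSpace V] [IsTopologicalAddGroup V] [ContinuousSMul ℝ V]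
    {C : PointedCone ℝ V} {y : V} (hy : y ∈ interior (C : Set V)) {T : Finset V}
    (hT : (T : Set V) ⊆ C) :
    ∃ b : Option T → V, (∀ i, b i ∈ C) ∧ ∑ i, b i = y ∧
      ∃ δ : ℝ, 0 < δ ∧ ∀ v : T, b (some v) = δ • (v : V) := by
  -- For small δ the remainder y - δ ∑ v stays in the cone; it fills the `none` slot.
  obtain ⟨δ, hδ, hmem⟩ := PointedCone.exists_add_smul_mem hy (-∑ v : T, (v : V))
  refine ⟨fun i => i.elim (y + δ • (-∑ v : T, (v : V))) fun v => δ • (v : V), ?_, ?_, δ, hδ,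
    fun v => rfl⟩
  · rintro (_ | v)
    · exact hmem
    · exact C.smul_mem hδ.le (hT v.2)
  · simp [Fintype.sum_option, Finset.smul_sum]

/-- The annihilator of the kernel of a linear map is the range of its transpose. -/
theorem exists_dual_of_orthogonal_relations {ι : Type*} [Fintype ι] {b : ι → V} {p : ι → ℝ}
    (h : ∀ r : ι → ℝ, ∑ i, r i • b i = 0 → ∑ i, r i * p i = 0) :
    ∃ g : Module.Dual ℝ V, ∀ i, g (b i) = p i := by
  classical
  let φ : Module.Dual ℝ (ι → ℝ) := Fintype.linearCombination ℝ p
  have hφ : φ ∈ LinearMap.range (Fintype.linearCombination ℝ b).dualMap := by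
    rw [LinearMap.range_dualMap_eq_dualAnnihilator_ker, Submodule.mem_dualAnnihilator]
    intro r hr
    simpa [φ, Fintype.linearCombination_apply] using h r (by
      simpa [Fintype.linearCombination_apply] using hr)
  obtain ⟨g, hg⟩ := hφ
  refine ⟨g, fun i => ?_⟩
  have := LinearMap.congr_fun hg (Pi.single i 1)
  simpa [φ, Fintype.linearCombination_apply_single] using this

/-- The empirical frequencies of a finite sequence. -/
noncomputable def empiricalFreq {ι : Type*} [DecidableEq ι] {k : ℕ} (f : Fin k → ι) (i : ι) : ℝ :=
  (k : ℝ)⁻¹ * ∑ s, if f s = i then 1 else 0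

theorem empiricalFreq_mem_stdSimplex {ι : Type*} [Fintype ι] [DecidableEq ι] {k : ℕ} (hk : 1 ≤ k)
    (f : Fin k → ι) : empiricalFreq f ∈ stdSimplex ℝ ι := by
  have hk0 : (k : ℝ) ≠ 0 := by positivity
  refine ⟨fun i => ?_, ?_⟩
  · exact mul_nonneg (by positivity) (Finset.sum_nonneg fun s _ => by split_ifs <;> norm_num)
  · simp only [empiricalFreq]
    rw [← Finset.mul_sum, Finset.sum_comm]
    simp [hk0]

theorem sum_comp_eq_smul_sum_empiricalFreq {ι M : Type*} [Fintype ι] [DecidableEq ι]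
    [AddCommGroup M] [Module ℝ M] {k : ℕ} (hk : 1 ≤ k) (f : Fin k → ι) (u : ι → M) :
    ∑ s, u (f s) = (k : ℝ) • ∑ i, empiricalFreq f i • u i := by
  have hk0 : (k : ℝ) ≠ 0 := by positivity
  simp only [empiricalFreq, mul_smul, ← Finset.smul_sum, smul_smul, mul_inv_cancel₀ hk0, one_smul,
    Finset.sum_smul]
  rw [Finset.sum_comm]
  simp

end Main

/-! ### Assembling relations, certificates and coefficients -/

/-- A basis of the space of relations suffices, so the penalty is a finite sum of squares. -/
theorem exists_spanning_relations {V ι : Type*} [AddCommGroup V] [Module ℝ V] [Fintype ι]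
    (b : ι → V) :
    ∃ (m : ℕ) (r : Fin m → ι → ℝ), (∀ j, ∑ i, r j i • b i = 0) ∧
      ∀ p : ι → ℝ, (∀ j, ∑ i, r j i * p i = 0) →
        ∀ r' : ι → ℝ, ∑ i, r' i • b i = 0 → ∑ i, r' i * p i = 0 := by
  classical
  let K := LinearMap.ker (Fintype.linearCombination ℝ b)
  refine ⟨finrank ℝ K, fun j => (finBasis ℝ K j : ι → ℝ), fun j => ?_, fun p hp r' hr' => ?_⟩
  · exact (Fintype.linearCombination_apply ℝ b _).symm.trans (finBasis ℝ K j).2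
  · have h0 : (Fintype.linearCombination ℝ p) ∘ₗ K.subtype = 0 :=
      (finBasis ℝ K).ext fun j => by
        simpa [Fintype.linearCombination_apply] using hp j
    have := LinearMap.congr_fun h0 ⟨r', by
      simpa [K, Fintype.linearCombination_apply] using hr'⟩
    simpa [Fintype.linearCombination_apply] using this

theorem exists_spanning_certificate {W V : Type*} [AddCommGroup W] [Module ℝ W]
    [AddCommGroup V] [Module ℝ V] [Module.Finite ℝ V] [TopologicalSpace W]
    [IsTopologicalAddGroup W] [ContinuousSMul ℝ W] [TopologicalSpace V]
    [IsTopologicalAddGroup V] [ContinuousSMul ℝ V] {CA : PointedCone ℝ W} {CB : PointedCone ℝ V}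
    (hspan : Submodule.span ℝ (CB : Set V) = ⊤) {x : W ⊗[ℝ] V}
    (hx : ∀ g : Module.Dual ℝ V, g ≠ 0 → (∀ v ∈ CB, 0 ≤ g v) →
      tensorContract g x ∈ interior (CA : Set W))
    {y : V} (hy : y ∈ interior (CB : Set V)) :
    ∃ (T : Finset V) (b : Option T → V), (∀ i, b i ∈ CB) ∧ ∑ i, b i = y ∧
      Submodule.span ℝ (Set.range b) = ⊤ ∧
      ∀ g : Module.Dual ℝ V, g ≠ 0 → (∀ i, 0 ≤ g (b i)) →
        tensorContract g x ∈ interior (CA : Set W) := by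
  classical
  obtain ⟨T₁, hT₁, hcert⟩ := exists_finset_certificate hx
  obtain ⟨T₂, hT₂, hT₂span⟩ := Submodule.fg_span_iff_fg_span_finset_subset (CB : Set V) |>.1
    (hspan ▸ Module.Finite.fg_top : (Submodule.span ℝ (CB : Set V)).FG)
  have hT : ((T₁ ∪ T₂ : Finset V) : Set V) ⊆ CB := by
    rw [Finset.coe_union]
    exact Set.union_subset hT₁ hT₂
  obtain ⟨b, hbC, hsum, δ, hδ, hb⟩ := exists_family_sum_eq hy hT
  refine ⟨T₁ ∪ T₂, b, hbC, hsum, ?_, fun g hg hgb => hcert g hg fun v hv => ?_⟩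
  · rw [eq_top_iff, ← hspan, hT₂span, Submodule.span_le]
    intro v hv
    have := hb ⟨v, Finset.mem_union_right _ hv⟩
    have hv' : v = δ⁻¹ • b (some ⟨v, Finset.mem_union_right _ hv⟩) := by
      rw [this, smul_smul, inv_mul_cancel₀ hδ.ne', one_smul]
    rw [hv']
    exact Submodule.smul_mem _ _ (Submodule.subset_span (Set.mem_range_self _))
  · have := hgb (some ⟨v, Finset.mem_union_left _ hv⟩)
    rw [hb, map_smul, smul_eq_mul] at this
    exact (mul_nonneg_iff_of_pos_left hδ).1 this

theorem PointedCone.exists_symmetrization_coefficients_mem {W ι J : Type*} [AddCommGroup W]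
    [Module ℝ W] [TopologicalSpace W] [IsTopologicalAddGroup W] [ContinuousSMul ℝ W] [Fintype ι]
    [Fintype J] {C : PointedCone ℝ W} {a : W} (ha : a ∈ interior (C : Set W)) (xs : ι → W)
    (r : J → ι → ℝ)
    (h : ∀ p ∈ stdSimplex ℝ ι, (∀ j, ∑ i, r j i * p i = 0) →
      ∑ i, p i • xs i ∈ interior (C : Set W)) :
    ∃ (k : ℕ) (_ : 1 ≤ k) (c : ℝ), ∀ f : Fin k → ι,
      (1 / (k : ℝ)) • ∑ s, xs (f s) +
        (c * ∑ j, ((∑ s, r j (f s)) ^ 2 - ∑ s, r j (f s) ^ 2)) • a ∈ C := by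
  classical
  let q : (ι → ℝ) → ℝ := fun p => ∑ j, (∑ i, r j i * p i) ^ 2
  let R : ι → ℝ := fun i => ∑ j, r j i ^ 2
  have hR : ∀ i, 0 ≤ R i := fun i => Finset.sum_nonneg fun j _ => sq_nonneg _
  obtain ⟨m, hm, hmem⟩ := PointedCone.exists_penalty (q := q) (D := ∑ i, R i) ha xs
    (by fun_prop) (fun p => Finset.sum_nonneg fun j _ => sq_nonneg _)
    (Finset.sum_nonneg fun i _ => hR i) (fun p hp hqp => h p hp fun j => by
      have := (Finset.sum_eq_zero_iff_of_nonneg (fun j _ => sq_nonneg _)).1 hqp j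
        (Finset.mem_univ j)
      exact pow_eq_zero_iff two_ne_zero |>.1 this)
  have hm0 : (0 : ℝ) < m := by exact_mod_cast hm
  have hk : 1 ≤ m * m := Nat.mul_pos hm hm
  -- With k = m² and c = m/k², the correction c(k² q(p) - k ∑ p_i R_i) equals m q(p) - (∑ p_i
  -- R_i)/m.
  refine ⟨m * m, hk, m / ((m * m : ℕ) : ℝ) ^ 2, fun f => ?_⟩
  have hp := empiricalFreq_mem_stdSimplex hk f
  set p := empiricalFreq f with hpdef
  have hRp : ∑ i, p i * R i ≤ ∑ i, R i := Finset.sum_le_sum fun i _ =>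
    mul_le_of_le_one_left (hR i)
      (hp.2 ▸ Finset.single_le_sum (fun j _ => hp.1 j) (Finset.mem_univ i))
  -- The penalty bound allows for the loss D/m with D = ∑ R_i; the excess over the true loss is
  -- returned as a multiple of `a`.
  have hfin := C.add_mem (interior_subset (hmem p hp))
    (C.smul_mem (r := (∑ i, R i - ∑ i, p i * R i) / m)
      (div_nonneg (sub_nonneg.2 hRp) hm0.le) (interior_subset ha))
  rw [add_assoc, ← add_smul] at hfin
  convert hfin using 3
  · rw [sum_comp_eq_smul_sum_empiricalFreq hk f, smul_smul, one_div, inv_mul_cancel₀, one_smul]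
    positivity
  · have h1 : ∀ j, ∑ s, r j (f s) = ((m * m : ℕ) : ℝ) * ∑ i, r j i * p i := fun j => by
      rw [sum_comp_eq_smul_sum_empiricalFreq hk f, smul_eq_mul]
      simp only [smul_eq_mul, mul_comm, ← hpdef]
    have h2 : ∑ j, ∑ s, r j (f s) ^ 2 = ((m * m : ℕ) : ℝ) * ∑ i, p i * R i := by
      rw [Finset.sum_comm]
      exact sum_comp_eq_smul_sum_empiricalFreq hk f R
    rw [Finset.sum_sub_distrib, h2]
    simp only [h1, mul_pow, ← Finset.mul_sum]
    change _ * (_ * q p - _) = _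
    push_cast
    field_simp
    ring

theorem theorem4 {VA VB : Type*} [AddCommGroup VA] [Module ℝ VA] [Module.Finite ℝ VA]
    [AddCommGroup VB] [Module ℝ VB] [Module.Finite ℝ VB]
    (CA : PointedCone ℝ VA) (CB : PointedCone ℝ VB)
    (hCA : ConeTensor.IsProper CA) (hCB : ConeTensor.IsProper CB)
    (x : VA ⊗[ℝ] VB) (hx : x ∈ ConeTensor.inter (PointedCone.maxTensorProduct CA CB))
    (y : VB) (hy : y ∈ ConeTensor.inter CB) :
    ∃ (k : ℕ) (hk : 1 ≤ k),
      (TensorProduct.map LinearMap.id (ConeTensor.symProj VB k))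
          ((TensorProduct.map LinearMap.id (ConeTensor.tmulPow k hk y)) x) ∈
        PointedCone.minTensorProduct CA (ConeTensor.minTensorPower k CB) := by
  classical
  let := moduleTopology ℝ VA
  let := moduleTopology ℝ VB
  have : IsModuleTopology ℝ VA := ⟨rfl⟩
  have : IsModuleTopology ℝ VB := ⟨rfl⟩
  have : ContinuousSMul ℝ VA := IsModuleTopology.toContinuousSMul ℝ VA
  have : ContinuousSMul ℝ VB := IsModuleTopology.toContinuousSMul ℝ VB
  have : IsTopologicalAddGroup VA := IsModuleTopology.topologicalAddGroup ℝ VA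
  have : IsTopologicalAddGroup VB := IsModuleTopology.topologicalAddGroup ℝ VB
  obtain ⟨a, ha⟩ : (interior (CA : Set VA)).Nonempty :=
    PointedCone.interior_nonempty_of_span_eq_top
      (PointedCone.span_eq_top_of_not_le_hyperplane hCA.not_le_hyperplane)
  obtain ⟨T, b, hbC, rfl, hspan, hcert⟩ := exists_spanning_certificate
    (PointedCone.span_eq_top_of_not_le_hyperplane hCB.not_le_hyperplane)
    (fun g hg hgC => tensorContract_mem_inter hCA.isClosed hx hg hgC) hy
  obtain ⟨xs, rfl⟩ := TensorProduct.exists_eq_sum_tmul hspan x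
  obtain ⟨n, r, hr, hrel⟩ := exists_spanning_relations b
  obtain ⟨k, hk, c, hmem⟩ := PointedCone.exists_symmetrization_coefficients_mem ha xs r
    (fun p hp horth => by
      obtain ⟨g, hg⟩ := exists_dual_of_orthogonal_relations (hrel p horth)
      -- If g were zero, all frequencies would vanish, though they sum to 1.
      have hg0 : g ≠ 0 := by
        rintro rfl
        have := hp.2
        simp [← hg] at this
      simpa [hg] using hcert g hg0 fun i => (hg i).symm ▸ hp.1 i)
  refine ⟨k, hk, ?_⟩
  rw [ConeTensor.symProj_tmulPow_expansion k hk b xs r hr c a]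
  exact Submodule.sum_mem _ fun f _ => PointedCone.tmul_mem_minTensorProduct (hmem f)
    (Submodule.subset_span ⟨fun l => b (f l), fun l => hbC _, rfl⟩)
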